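/- Let $L>0$, let $a,b\in C^1([0,L],\mathbb R)$ and $\tilde a,\tilde b\in C^0([0,L],\mathbb R)$, and let $\alpha_h,\alpha_q,\beta_h,\beta_q\in\mathbb R$. Consider, for $\tilde z=(\tilde h,\tilde q)^T$, the linear $2\times 2$ system on $[0,+\infty)\times[0,L]$ $$\tilde z_t+A(x)\tilde z_x+B(x)\tilde z=0,\qquad A=\begin{pmatrix}0&1\\ a&b\end{pmatrix},\quad B=\begin{pmatrix}0&0\\ a_x+\tilde a& b_x+\tilde b\end{pmatrix},$$ with the boundary conditions $$\alpha_h\tilde h(t,0)+\alpha_q\tilde q(t,0)=0,\qquad \beta_h\tilde h(t,L)+\beta_q\tilde q(t,L)=0 .$$ Assume that it is hyperbolic with characteristic velocities of opposite signs: for all $x\in[0,L]$, $b^2(x)+4a(x)>0$ and $A(x)$ has the eigenvalues $\lambda_1(x)>0$ and $-\lambda_2(x)<0$, where $\lambda_1=\frac{b+\sqrt{b^2+4a}}2$ and $-\lambda_2=\frac{b-\sqrt{b^2+4a}}2$. For two functions $p_1,p_2$ on $[0,L]$ put $$N=\begin{pmatrix}\lambda_2&1\\-\lambda_1&1\end{pmatrix},\qquad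 P=N^T\begin{pmatrix}p_1&0\\0&p_2\end{pmatrix}N,\qquad M=PA .$$ Suppose that there exist $p_1,p_2\in C^1([0,L],(0,+\infty))$ such that (a1) $\alpha_h+\alpha_q\lambda_1(0)\neq 0$ and $\displaystyle\left(\frac{\alpha_h-\alpha_q\lambda_2(0)}{\alpha_h+\alpha_q\lambda_1(0)}\right)^{2}<\frac{p_2(0)}{p_1(0)}\,\frac{\lambda_2(0)}{\lambda_1(0)}$, (a2) $\beta_h-\beta_q\lambda_2(L)\neq 0$ and $\displaystyle\left(\frac{\beta_h+\beta_q\lambda_1(L)}{\beta_h-\beta_q\lambda_2(L)}\right)^{2}<\frac{p_1(L)}{p_2(L)}\,\frac{\lambda_1(L)}{\lambda_2(L)}$, (b) the matrix $-M_x(x)+B^T(x)P(x)+P(x)B(x)$ is positive definite for all $x\in[0,L]$. Then the system is $L^2$-exponentially stable: there exist constants $C>0$ and $\nu>0$ such that for every initial condition $\tilde z_0\in L^2([0,L],\mathbb R^2)$ every $L^2$-solution $\tilde z$ with $\tilde z(0,\cdot)=\tilde z_0$ satisfies $$\|\tilde z(t,\cdot)\|_{L^2}\le C e^{-\nu t}\|\tilde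 z_0\|_{L^2},\qquad t\in[0,+\infty).$$ Here an $L^2$-solution is a map $\tilde z\in C^0([0,+\infty);L^2([0,L],\mathbb R^2))$ with $\tilde z(0,\cdot)=\tilde z_0$ such that $$\int_0^L\varphi(\tau,x)^T\tilde z(\tau,x)\,dx-\int_0^L\varphi(0,x)^T\tilde z_0(x)\,dx=\int_0^\tau\!\!\int_0^L\big(\varphi_t+(A^T\varphi)_x-B^T\varphi\big)^T\tilde z\,dx\,dt$$ for every $\tau>0$ and every $\varphi\in C^1([0,\tau]\times[0,L],\mathbb R^2)$ satisfying the adjoint boundary conditions: for all $t\in[0,\tau]$, $\varphi(t,0)^TA(0)\xi=0$ for every $\xi\in\mathbb R^2$ with $\alpha_h\xi_1+\alpha_q\xi_2=0$, and $\varphi(t,L)^TA(L)\xi=0$ for every $\xi\in\mathbb R^2$ with $\beta_h\xi_1+\beta_q\xi_2=0$. -/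

import Mathlib

open MeasureTheory Set
open scoped Matrix

/-- Data of the linearized error system on `[0, L]`
  `h_t + q_x = 0`,
  `q_t + a h_x + b q_x + (a_x + ã) h + (b_x + b̃) q = 0`,
with boundary conditions
  `α_h h(t,0) + α_q q(t,0) = 0` and `β_h h(t,L) + β_q q(t,L) = 0`. -/
structure ErrorSystem where
  L : ℝ
  a : ℝ → ℝ
  b : ℝ → ℝ
  aTilde : ℝ → ℝ
  bTilde : ℝ → ℝ
  αh : ℝ
  αq : ℝ
  βh : ℝ
  βq : ℝ

namespace ErrorSystem

noncomputable section

/-- Regularity of the coefficients: `L > 0`, `a, b ∈ C¹([0,L])`, `ã, b̃ ∈ C⁰([0,L])`. -/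
structure IsRegular (S : ErrorSystem) : Prop where
  L_pos : 0 < S.L
  a_contDiffOn : ContDiffOn ℝ 1 S.a (Icc 0 S.L)
  b_contDiffOn : ContDiffOn ℝ 1 S.b (Icc 0 S.L)
  aTilde_continuousOn : ContinuousOn S.aTilde (Icc 0 S.L)
  bTilde_continuousOn : ContinuousOn S.bTilde (Icc 0 S.L)

/-- The matrix `A(x)` of the system `z_t + A z_x + B z = 0`. -/
def A (S : ErrorSystem) (x : ℝ) : Matrix (Fin 2) (Fin 2) ℝ :=
  !![0, 1; S.a x, S.b x]

/-- The matrix `B(x)` of the system `z_t + A z_x + B z = 0`. -/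
def B (S : ErrorSystem) (x : ℝ) : Matrix (Fin 2) (Fin 2) ℝ :=
  !![0, 0;
     derivWithin S.a (Icc 0 S.L) x + S.aTilde x, derivWithin S.b (Icc 0 S.L) x + S.bTilde x]

/-- `λ₁(x)`, the first eigenvalue of `A(x)`. -/
def lam1 (S : ErrorSystem) (x : ℝ) : ℝ :=
  (S.b x + Real.sqrt (S.b x ^ 2 + 4 * S.a x)) / 2

/-- `λ₂(x)`, where `-λ₂(x)` is the second eigenvalue of `A(x)`. -/
def lam2 (S : ErrorSystem) (x : ℝ) : ℝ :=
  -((S.b x - Real.sqrt (S.b x ^ 2 + 4 * S.a x)) / 2)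

/-- Hyperbolicity with characteristic velocities of opposite signs: on `[0,L]` the matrix `A(x)`
has the two real distinct eigenvalues `λ₁(x) > 0` and `-λ₂(x) < 0`. -/
structure IsHyperbolic (S : ErrorSystem) : Prop where
  disc_pos : ∀ x ∈ Icc 0 S.L, 0 < S.b x ^ 2 + 4 * S.a x
  lam1_pos : ∀ x ∈ Icc 0 S.L, 0 < S.lam1 x
  lam2_pos : ∀ x ∈ Icc 0 S.L, 0 < S.lam2 x

/-- The diagonalizing matrix: `N(x) A(x) = Λ(x) N(x)` with `Λ = diag(λ₁, -λ₂)`. -/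
def N (S : ErrorSystem) (x : ℝ) : Matrix (Fin 2) (Fin 2) ℝ :=
  !![S.lam2 x, 1; -S.lam1 x, 1]

/-- `P(x) = N(x)ᵀ diag(p₁(x), p₂(x)) N(x)`. -/
def P (S : ErrorSystem) (p₁ p₂ : ℝ → ℝ) (x : ℝ) : Matrix (Fin 2) (Fin 2) ℝ :=
  (S.N x)ᵀ * !![p₁ x, 0; 0, p₂ x] * S.N x

/-- `M(x) = P(x) A(x)`. -/
def M (S : ErrorSystem) (p₁ p₂ : ℝ → ℝ) (x : ℝ) : Matrix (Fin 2) (Fin 2) ℝ :=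
  S.P p₁ p₂ x * S.A x

/-- The entrywise derivative `M_x(x)` on `[0,L]` (one-sided at the end points). -/
def Mx (S : ErrorSystem) (p₁ p₂ : ℝ → ℝ) (x : ℝ) : Matrix (Fin 2) (Fin 2) ℝ :=
  Matrix.of fun i j => derivWithin (fun y => S.M p₁ p₂ y i j) (Icc 0 S.L) x

/-- A weight in `C¹([0,L], (0,+∞))`. -/
def IsWeight (S : ErrorSystem) (p : ℝ → ℝ) : Prop :=
  ContDiffOn ℝ 1 p (Icc 0 S.L) ∧ ∀ x ∈ Icc 0 S.L, 0 < p x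

/-- The condition (a1) at `x = 0`; the fraction on its left-hand side has to be defined. -/
def ConditionA1 (S : ErrorSystem) (p₁ p₂ : ℝ → ℝ) : Prop :=
  S.αh + S.αq * S.lam1 0 ≠ 0 ∧
    ((S.αh - S.αq * S.lam2 0) / (S.αh + S.αq * S.lam1 0)) ^ 2
      < p₂ 0 / p₁ 0 * (S.lam2 0 / S.lam1 0)

/-- The condition (a2) at `x = L`; the fraction on its left-hand side has to be defined. -/
def ConditionA2 (S : ErrorSystem) (p₁ p₂ : ℝ → ℝ) : Prop :=
  S.βh - S.βq * S.lam2 S.L ≠ 0 ∧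
    ((S.βh + S.βq * S.lam1 S.L) / (S.βh - S.βq * S.lam2 S.L)) ^ 2
      < p₁ S.L / p₂ S.L * (S.lam1 S.L / S.lam2 S.L)

/-- The condition (b): `-M_x + Bᵀ P + P B` is positive definite at every point of `[0,L]`. -/
def ConditionB (S : ErrorSystem) (p₁ p₂ : ℝ → ℝ) : Prop :=
  ∀ x ∈ Icc 0 S.L,
    (-S.Mx p₁ p₂ x + (S.B x)ᵀ * S.P p₁ p₂ x + S.P p₁ p₂ x * S.B x).PosDef

/-- The state space `L²([0,L], ℝ²)`, with `ℝ²` Euclidean. -/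
abbrev State (S : ErrorSystem) : Type :=
  Lp (EuclideanSpace ℝ (Fin 2)) 2 (volume.restrict (Icc 0 S.L))

/-- Test functions on `[0,τ] × [0,L]`: those of class `C¹` that satisfy the adjoint boundary
conditions, i.e. for which the boundary terms `φᵀ A z` vanish at `x = 0` and at `x = L` for
every value of `z` that satisfies the boundary condition there. -/
structure IsTest (S : ErrorSystem) (τ : ℝ) (φ : ℝ → ℝ → Fin 2 → ℝ) : Prop where
  contDiffOn : ContDiffOn ℝ 1 (fun y : ℝ × ℝ => φ y.1 y.2) (Icc 0 τ ×ˢ Icc 0 S.L)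
  left : ∀ t ∈ Icc 0 τ, ∀ ξ : Fin 2 → ℝ,
    S.αh * ξ 0 + S.αq * ξ 1 = 0 → φ t 0 ⬝ᵥ (S.A 0 *ᵥ ξ) = 0
  right : ∀ t ∈ Icc 0 τ, ∀ ξ : Fin 2 → ℝ,
    S.βh * ξ 0 + S.βq * ξ 1 = 0 → φ t S.L ⬝ᵥ (S.A S.L *ᵥ ξ) = 0

/-- The formal adjoint of `∂_t + A ∂_x + B`, up to sign: `φ_t + (Aᵀ φ)_x - Bᵀ φ`. -/
def adjointOp (S : ErrorSystem) (τ : ℝ) (φ : ℝ → ℝ → Fin 2 → ℝ) (t x : ℝ) : Fin 2 → ℝ :=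
  derivWithin (fun s => φ s x) (Icc 0 τ) t
    + derivWithin (fun y => (S.A y)ᵀ *ᵥ φ t y) (Icc 0 S.L) x
    - (S.B x)ᵀ *ᵥ φ t x

/-- `z` is an `L²`-solution on `[0,+∞)` of the Cauchy problem with initial condition `z₀`:
`z ∈ C⁰([0,+∞); L²)`, `z(0) = z₀`, and the equation and the boundary conditions hold
in the weak sense. -/
structure IsL2Solution (S : ErrorSystem) (z₀ : S.State) (z : ℝ → S.State) : Prop where
  continuousOn : ContinuousOn z (Ici 0)
  initial : z 0 = z₀
  weak : ∀ τ : ℝ, 0 < τ → ∀ φ : ℝ → ℝ → Fin 2 → ℝ, S.IsTest τ φ →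
    (∫ x in Icc 0 S.L, φ τ x ⬝ᵥ (z τ x).ofLp) - (∫ x in Icc 0 S.L, φ 0 x ⬝ᵥ (z₀ x).ofLp)
      = ∫ t in Icc 0 τ, ∫ x in Icc 0 S.L, S.adjointOp τ φ t x ⬝ᵥ (z t x).ofLp

/-- `L²`-exponential stability. -/
def IsL2ExpStable (S : ErrorSystem) : Prop :=
  ∃ C : ℝ, 0 < C ∧ ∃ ν : ℝ, 0 < ν ∧
    ∀ (z₀ : S.State) (z : ℝ → S.State), S.IsL2Solution z₀ z →
      ∀ t : ℝ, 0 ≤ t → ‖z t‖ ≤ C * Real.exp (-ν * t) * ‖z₀‖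

end

end ErrorSystem

open Filter Topology InnerProductSpace

/-! The natural Lyapunov functional is `V(z) = ∫ zᵀ P z dx`. For a smooth solution, symmetry of `M =
P A` gives `V' = -[zᵀ M z]₀ᴸ - ∫ zᵀ (-M_x + Bᵀ P + P B) z`. In the characteristic coordinates `N z`
the form of `M` is diagonal, and (a1), (a2) give the two boundary terms the right sign; (b) and
compactness bound the integral below by `m ‖z‖²`.

An `L²`-solution has no traces or derivatives, so the computation is made on the time integrals `w =
∫_t^{t+ε} z`. Their time derivative is `v = z (t + ε) - z t`, and time-independent test functions
show that `v + A w' + B w = 0` weakly, with the boundary conditions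
(`IsL2Solution.weak_stationary`). Since `A` is invertible, `w` is absolutely continuous in `x` and
has genuine boundary values (`exists_isIntegralPrimitive_of_weak_bvp`), so the formal computation is
legitimate for `w` (`dissipation`). A Gronwall argument for `w`, followed by division by `ε²` and `ε
→ 0`, gives the decay of `z` itself (`exists_exp_decay_of_dissipative_averages`). -/

/-! ### Exponential decay from time averages in a Hilbert space -/

/-- If the running integrals of a continuous curve satisfy a dissipation inequality for an
equivalent scalar product, then the curve decays exponentially. -/
theorem exists_exp_decay_of_dissipative_averages {H : Type*} [NormedAddCommGroup H]
    [InnerProductSpace ℝ H] [CompleteSpace H] (T : H →L[ℝ] H)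
    (hsymm : ∀ u v : H, ⟪T u, v⟫_ℝ = ⟪u, T v⟫_ℝ) {c m : ℝ} (hc : 0 < c) (hm : 0 < m)
    (hcoer : ∀ u : H, c * ‖u‖ ^ 2 ≤ ⟪u, T u⟫_ℝ) :
    ∃ C : ℝ, 0 < C ∧ ∃ ν : ℝ, 0 < ν ∧ ∀ z : ℝ → H, ContinuousOn z (Ici 0) →
      (∀ t, 0 ≤ t → ∀ ε, 0 < ε →
        2 * ⟪z (t + ε) - z t, T (∫ s in t..t + ε, z s)⟫_ℝ ≤ -m * ‖∫ s in t..t + ε, z s‖ ^ 2) →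
      ∀ t, 0 ≤ t → ‖z t‖ ≤ C * Real.exp (-ν * t) * ‖z 0‖ := by
  set K : ℝ := ‖T‖ + 1 with hK
  have hKpos : 0 < K := by positivity
  have hupper : ∀ u : H, ⟪u, T u⟫_ℝ ≤ K * ‖u‖ ^ 2 := fun u => by
    have h1 := real_inner_le_norm u (T u)
    have h2 := T.le_opNorm u
    nlinarith [norm_nonneg u, mul_le_mul_of_nonneg_left h2 (norm_nonneg u), sq_nonneg ‖u‖]
  -- The functional lies between `c ‖u‖²` and `K ‖u‖²` and decays at rate `m / K`; taking square
  -- roots gives these constants.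
  refine ⟨√(K / c), by positivity, m / (2 * K), by positivity, fun z hz hdiss t ht => ?_⟩
  -- Freezing `z` at negative times gives a curve continuous on all of `ℝ`, so its primitive has
  -- two-sided derivatives at `0` too.
  set y : ℝ → H := fun s => z (max s 0) with hy
  have hycont : Continuous y :=
    hz.comp_continuous (by fun_prop) (fun s => le_max_right s 0)
  have hyz : ∀ s, 0 ≤ s → y s = z s := fun s hs => by simp [hy, max_eq_left hs]
  have hprim : ∀ s, HasDerivAt (fun r => ∫ x in (0 : ℝ)..r, y x) (y s) s := fun s =>
    intervalIntegral.integral_hasDerivAt_right (hycont.intervalIntegrable _ _)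
      hycont.aestronglyMeasurable.stronglyMeasurableAtFilter hycont.continuousAt
  -- Gronwall at fixed `ε`: the curve is only continuous, but its running integral is
  -- differentiable.
  have key : ∀ ε, 0 < ε →
      Real.exp (m / K * t) * ⟪∫ s in t..t + ε, y s, T (∫ s in t..t + ε, y s)⟫_ℝ
        ≤ ⟪∫ s in (0 : ℝ)..0 + ε, y s, T (∫ s in (0 : ℝ)..0 + ε, y s)⟫_ℝ := by
    intro ε hε
    set Y : ℝ → H := fun r => ∫ s in r..r + ε, y s with hY
    have hYd : ∀ r, HasDerivAt Y (y (r + ε) - y r) r := fun r => by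
      have h1 : HasDerivAt (fun r => ∫ x in (0 : ℝ)..r + ε, y x) (y (r + ε)) r :=
        (hprim (r + ε)).comp_add_const r ε
      have h2 := h1.sub (hprim r)
      refine h2.congr_of_eventuallyEq (Eventually.of_forall fun q => ?_)
      simp only [hY, Pi.sub_apply]
      rw [intervalIntegral.integral_interval_sub_left] <;> exact hycont.intervalIntegrable _ _
    have hVd : ∀ r, HasDerivAt (fun r => Real.exp (m / K * r) * ⟪Y r, T (Y r)⟫_ℝ)
        (Real.exp (m / K * r) * (m / K) * ⟪Y r, T (Y r)⟫_ℝ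
          + Real.exp (m / K * r) * (2 * ⟪y (r + ε) - y r, T (Y r)⟫_ℝ)) r := fun r => by
      have h1 : HasDerivAt (fun r => Real.exp (m / K * r)) (Real.exp (m / K * r) * (m / K)) r := by
        simpa using ((hasDerivAt_id r).const_mul (m / K)).exp
      have h2 := (hYd r).inner ℝ (T.hasFDerivAt.comp_hasDerivAt r (hYd r))
      convert! h1.mul h2 using 2
      simp only [Function.comp_apply]
      rw [← hsymm (Y r), real_inner_comm (y (r + ε) - y r) (T (Y r))]
      ring
    have hanti : AntitoneOn (fun r => Real.exp (m / K * r) * ⟪Y r, T (Y r)⟫_ℝ) (Ici 0) := by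
      refine antitoneOn_of_deriv_nonpos (convex_Ici 0)
        (fun r _ => (hVd r).continuousAt.continuousWithinAt)
        (fun r _ => (hVd r).differentiableAt.differentiableWithinAt) fun r hr => ?_
      rw [interior_Ici] at hr
      have hr0 : 0 ≤ r := le_of_lt hr
      have hYz : Y r = ∫ s in r..r + ε, z s :=
        intervalIntegral.integral_congr fun s hs => by
          rw [uIcc_of_le (by linarith)] at hs
          exact hyz s (hr0.trans hs.1)
      have h1 := hdiss r hr0 ε hε
      rw [← hYz, ← hyz r hr0, ← hyz (r + ε) (by linarith)] at h1
      rw [(hVd r).deriv]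
      have h2 : m / K * ⟪Y r, T (Y r)⟫_ℝ ≤ m * ‖Y r‖ ^ 2 := by
        calc m / K * ⟪Y r, T (Y r)⟫_ℝ ≤ m / K * (K * ‖Y r‖ ^ 2) :=
              mul_le_mul_of_nonneg_left (hupper _) (by positivity)
          _ = m * ‖Y r‖ ^ 2 := by field_simp
      nlinarith [Real.exp_pos (m / K * r)]
    have := hanti (mem_Ici.2 le_rfl) (mem_Ici.2 ht) ht
    simpa [hY] using this
  have hlim : ∀ s, Tendsto (fun ε : ℝ => ⟪ε⁻¹ • ∫ x in s..s + ε, y x,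
      T (ε⁻¹ • ∫ x in s..s + ε, y x)⟫_ℝ) (𝓝[>] 0) (𝓝 ⟪y s, T (y s)⟫_ℝ) := fun s => by
    have h1 := (hprim s).tendsto_slope_zero_right
    have h2 : Tendsto (fun ε : ℝ => ε⁻¹ • ∫ x in s..s + ε, y x) (𝓝[>] 0) (𝓝 (y s)) := by
      refine h1.congr fun ε => ?_
      rw [intervalIntegral.integral_interval_sub_left] <;> exact hycont.intervalIntegrable _ _
    exact h2.inner ((T.continuous.tendsto _).comp h2)
  have hle : Real.exp (m / K * t) * ⟪y t, T (y t)⟫_ℝ ≤ ⟪y 0, T (y 0)⟫_ℝ := by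
    refine le_of_tendsto_of_tendsto ((hlim t).const_mul _) (hlim 0) ?_
    filter_upwards [self_mem_nhdsWithin] with ε hε
    -- The functional is quadratic, so the factor `ε⁻²` turns integrals into averages.
    have h := mul_le_mul_of_nonneg_left (key ε hε) (sq_nonneg ε⁻¹)
    simp only [map_smul, real_inner_smul_left, real_inner_smul_right]
    linarith
  rw [hyz t ht, hyz 0 le_rfl] at hle
  have h3 : c * ‖z t‖ ^ 2 * Real.exp (m / K * t) ≤ K * ‖z 0‖ ^ 2 := by
    nlinarith [hupper (z 0), hcoer (z t), Real.exp_pos (m / K * t)]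
  have h4 : ‖z t‖ ^ 2 ≤ (√(K / c) * Real.exp (-(m / (2 * K)) * t) * ‖z 0‖) ^ 2 := by
    have h5 : Real.exp (-(m / (2 * K)) * t) ^ 2 = (Real.exp (m / K * t))⁻¹ := by
      rw [← Real.exp_nat_mul, ← Real.exp_neg]
      congr 1
      push_cast
      field_simp
    rw [mul_pow, mul_pow, Real.sq_sqrt (by positivity), h5]
    have : K / c * (Real.exp (m / K * t))⁻¹ * ‖z 0‖ ^ 2
        = K * ‖z 0‖ ^ 2 / (c * Real.exp (m / K * t)) := by field_simp
    rw [this, le_div_iff₀ (by positivity)]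
    linarith
  exact (sq_le_sq₀ (norm_nonneg _) (by positivity)).1 h4

/-! ### Calculus of absolutely continuous functions -/

/-- `F` is a primitive on `[0, L]` of the integrable function `f`. -/
structure IsIntegralPrimitive (L : ℝ) (F f : ℝ → ℝ) : Prop where
  intervalIntegrable : IntervalIntegrable f volume 0 L
  eq_add_integral : ∀ x ∈ Icc 0 L, F x = F 0 + ∫ y in (0 : ℝ)..x, f y

namespace IsIntegralPrimitive

variable {L : ℝ} {F f G g : ℝ → ℝ}

theorem integral_eq_sub (hF : IsIntegralPrimitive L F f) (hL : 0 ≤ L) :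
    ∫ x in (0 : ℝ)..L, f x = F L - F 0 := by
  rw [hF.eq_add_integral L ⟨hL, le_rfl⟩]; ring

theorem continuousOn (hF : IsIntegralPrimitive L F f) (hL : 0 ≤ L) : ContinuousOn F (Icc 0 L) := by
  have h1 := intervalIntegral.continuousOn_primitive_interval
    (μ := volume) (f := f) (a := 0) (b := L)
    (by rw [uIcc_of_le hL]; exact (intervalIntegrable_iff_integrableOn_Icc_of_le hL).1 hF.1)
  rw [uIcc_of_le hL] at h1
  exact (continuousOn_const.add h1).congr hF.eq_add_integral

theorem of_contDiffOn (hL : 0 < L) (hF : ContDiffOn ℝ 1 F (Icc 0 L)) :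
    IsIntegralPrimitive L F (derivWithin F (Icc 0 L)) := by
  have hc : ContinuousOn (derivWithin F (Icc 0 L)) (Icc 0 L) :=
    hF.continuousOn_derivWithin (uniqueDiffOn_Icc hL) le_rfl
  have hi : IntervalIntegrable (derivWithin F (Icc 0 L)) volume 0 L :=
    (by rwa [uIcc_of_le hL.le] : ContinuousOn _ (uIcc 0 L)).intervalIntegrable
  refine ⟨hi, fun x hx => ?_⟩
  rw [intervalIntegral.integral_eq_sub_of_hasDeriv_right_of_le hx.1
    (f := F) (hF.continuousOn.mono (Icc_subset_Icc_right hx.2))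
    (f' := derivWithin F (Icc 0 L)) ?_ (hi.mono_set ?_)]
  · ring
  · intro y hy
    have hy' : y ∈ Icc 0 L := ⟨hy.1.le, hy.2.le.trans hx.2⟩
    have h1 := ((hF.differentiableOn one_ne_zero) y hy').hasDerivWithinAt
    exact (h1.hasDerivAt (Icc_mem_nhds hy.1 (hy.2.trans_le hx.2))).hasDerivWithinAt
  · rw [uIcc_of_le hx.1, uIcc_of_le hL.le]
    exact Icc_subset_Icc_right hx.2

theorem add (hF : IsIntegralPrimitive L F f) (hG : IsIntegralPrimitive L G g) :
    IsIntegralPrimitive L (fun x => F x + G x) (fun x => f x + g x) := by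
  refine ⟨hF.1.add hG.1, fun x hx => ?_⟩
  have hs : uIcc 0 x ⊆ uIcc 0 L := by
    rw [uIcc_of_le hx.1, uIcc_of_le (hx.1.trans hx.2)]; exact Icc_subset_Icc_right hx.2
  rw [intervalIntegral.integral_add (hF.1.mono_set hs) (hG.1.mono_set hs),
    hF.eq_add_integral x hx, hG.eq_add_integral x hx]
  ring

/-- Integration by parts for absolutely continuous functions: by Lebesgue differentiation their
derivatives are `f` and `g` almost everywhere, which suffices under the integral. -/
theorem mul (hL : 0 ≤ L) (hF : IsIntegralPrimitive L F f) (hG : IsIntegralPrimitive L G g) :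
    IsIntegralPrimitive L (fun x => F x * G x) (fun x => f x * G x + F x * g x) := by
  have hFc : ContinuousOn F (uIcc 0 L) := by rw [uIcc_of_le hL]; exact hF.continuousOn hL
  have hGc : ContinuousOn G (uIcc 0 L) := by rw [uIcc_of_le hL]; exact hG.continuousOn hL
  refine ⟨(hF.1.mul_continuousOn hGc).add (hG.1.continuousOn_mul hFc), fun x hx => ?_⟩
  have hs : uIcc 0 x ⊆ uIcc 0 L := by
    rw [uIcc_of_le hx.1, uIcc_of_le (hx.1.trans hx.2)]; exact Icc_subset_Icc_right hx.2
  have hf := hF.1.mono_set hs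
  have hg := hG.1.mono_set hs
  have hconst : ∀ k : ℝ, AbsolutelyContinuousOnInterval (fun _ : ℝ => k) 0 x := fun k =>
    (LipschitzWith.const k).lipschitzOnWith.absolutelyContinuousOnInterval
  have acF := (hconst (F 0)).add (hf.absolutelyContinuousOnInterval_intervalIntegral
    (c := 0) (by simp))
  have acG := (hconst (G 0)).add (hg.absolutelyContinuousOnInterval_intervalIntegral
    (c := 0) (by simp))
  have key := acF.integral_deriv_mul_eq_sub acG
  have hx0 : (0 : ℝ) ∈ Icc 0 L := ⟨le_rfl, hL⟩
  simp only [Pi.add_apply, ← hF.eq_add_integral x hx, ← hG.eq_add_integral x hx,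
    ← hF.eq_add_integral 0 hx0, ← hG.eq_add_integral 0 hx0] at key
  suffices h : ∫ y in (0 : ℝ)..x, (f y * G y + F y * g y) = F x * G x - F 0 * G 0 by
    rw [h]; ring
  rw [← key]
  refine intervalIntegral.integral_congr_ae ?_
  filter_upwards [hf.ae_hasDerivAt_integral, hg.ae_hasDerivAt_integral] with y h1 h2 hy
  have hy' : y ∈ uIcc 0 x := uIoc_subset_uIcc hy
  have hyL : y ∈ Icc 0 L := by
    rw [uIcc_of_le hx.1] at hy'; exact ⟨hy'.1, hy'.2.trans hx.2⟩
  have d1 := ((h1 hy' 0 (by simp)).const_add (F 0)).deriv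
  have d2 := ((h2 hy' 0 (by simp)).const_add (G 0)).deriv
  have e1 : deriv ((fun _ : ℝ => F 0) + fun x => ∫ t in (0 : ℝ)..x, f t) y = f y := d1
  have e2 : deriv ((fun _ : ℝ => G 0) + fun x => ∫ t in (0 : ℝ)..x, g t) y = g y := d2
  rw [e1, e2, ← hF.eq_add_integral y hyL, ← hG.eq_add_integral y hyL]

theorem of_integral (hf : IntervalIntegrable f volume 0 L) (k : ℝ) :
    IsIntegralPrimitive L (fun x => k + ∫ y in (0 : ℝ)..x, f y) f :=
  ⟨hf, fun x _ => by simp⟩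

end IsIntegralPrimitive

/-! ### Regularity and boundary values of weak solutions -/

/-- The lemma of du Bois-Reymond: a function orthogonal to all continuous functions of mean zero
is constant. -/
theorem exists_ae_eq_const_of_integral_mul_eq_zero {L : ℝ} (hL : 0 < L) {f : ℝ → ℝ}
    (hf : IntervalIntegrable f volume 0 L)
    (h : ∀ η : ℝ → ℝ, Continuous η → ∫ x in (0 : ℝ)..L, η x = 0 →
      ∫ x in (0 : ℝ)..L, η x * f x = 0) :
    ∃ c : ℝ, ∀ᵐ x ∂volume.restrict (Icc 0 L), f x = c := by
  set c : ℝ := L⁻¹ * ∫ x in (0 : ℝ)..L, f x with hc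
  have hfc : IntervalIntegrable (fun x => f x - c) volume 0 L :=
    hf.sub intervalIntegrable_const
  have hmean : ∫ x in (0 : ℝ)..L, (f x - c) = 0 := by
    rw [intervalIntegral.integral_sub hf intervalIntegrable_const]
    simp [hc]
    field_simp
    simp
  refine ⟨c, ?_⟩
  have hint : IntegrableOn (fun x => f x - c) (Icc 0 L) :=
    (intervalIntegrable_iff_integrableOn_Icc_of_le hL.le).1 hfc
  have key : ∀ η : ℝ → ℝ, Continuous η → ∫ x in (0 : ℝ)..L, η x * (f x - c) = 0 := by
    intro η hη
    -- Subtracting its mean makes `η` admissible, and the correction vanishes because `f - c` has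
    -- mean zero.
    set k : ℝ := L⁻¹ * ∫ x in (0 : ℝ)..L, η x with hk
    have hηk : ∫ x in (0 : ℝ)..L, (η x - k) = 0 := by
      rw [intervalIntegral.integral_sub (hη.intervalIntegrable _ _) intervalIntegrable_const]
      simp [hk]
      field_simp
      simp
    have h1 := h (fun x => η x - k) (by fun_prop) hηk
    have h2 : ∫ x in (0 : ℝ)..L, η x * (f x - c)
        = (∫ x in (0 : ℝ)..L, (η x - k) * f x) - c * (∫ x in (0 : ℝ)..L, (η x - k))
          + k * ∫ x in (0 : ℝ)..L, (f x - c) := by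
      rw [← intervalIntegral.integral_const_mul, ← intervalIntegral.integral_const_mul,
        ← intervalIntegral.integral_sub, ← intervalIntegral.integral_add]
      · exact intervalIntegral.integral_congr fun x _ => by ring
      · exact (hf.continuousOn_mul (by fun_prop)).sub
          ((Continuous.intervalIntegrable (by fun_prop) _ _))
      · exact hfc.const_mul k
      · exact hf.continuousOn_mul (by fun_prop)
      · exact Continuous.intervalIntegrable (by fun_prop) _ _
    rw [h2, h1, hηk, hmean]
    simp
  have hloc : LocallyIntegrable ((Icc 0 L).indicator fun x => f x - c) volume :=
    ((integrable_indicator_iff measurableSet_Icc).2 hint).locallyIntegrable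
  have hzero := ae_eq_zero_of_integral_contDiff_smul_eq_zero hloc fun η hη _ => by
    have : (fun x => η x • (Icc 0 L).indicator (fun x => f x - c) x)
        = (Icc 0 L).indicator fun x => η x * (f x - c) := by
      ext x; by_cases hx : x ∈ Icc 0 L <;> simp [hx]
    rw [this, integral_indicator measurableSet_Icc, integral_Icc_eq_integral_Ioc,
      ← intervalIntegral.integral_of_le hL.le]
    exact key η hη.continuous
  rw [ae_restrict_iff' measurableSet_Icc]
  filter_upwards [hzero] with x hx hxI
  rw [indicator_of_mem hxI] at hx
  linarith

theorem IsIntegralPrimitive.of_contDiff {L : ℝ} {θ : ℝ → ℝ} (hθ : ContDiff ℝ 1 θ) :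
    IsIntegralPrimitive L θ (deriv θ) := by
  have hc : Continuous (deriv θ) := hθ.continuous_deriv le_rfl
  refine ⟨hc.intervalIntegrable _ _, fun x _ => ?_⟩
  rw [intervalIntegral.integral_deriv_eq_sub (fun y _ => hθ.differentiable one_ne_zero y)
    (hc.intervalIntegrable _ _)]
  ring

/-- An integrable function whose distributional derivative is the integrable function `g` is
almost everywhere equal to a primitive of `g`. -/
theorem exists_isIntegralPrimitive_of_weak_deriv {L : ℝ} (hL : 0 < L) {w g : ℝ → ℝ}
    (hw : IntervalIntegrable w volume 0 L) (hg : IntervalIntegrable g volume 0 L)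
    (h : ∀ θ : ℝ → ℝ, ContDiff ℝ 1 θ → θ 0 = 0 → θ L = 0 →
      ∫ x in (0 : ℝ)..L, (deriv θ x * w x + θ x * g x) = 0) :
    ∃ W : ℝ → ℝ, IsIntegralPrimitive L W g ∧ ∀ᵐ x ∂volume.restrict (Icc 0 L), w x = W x := by
  have hG := IsIntegralPrimitive.of_integral hg 0
  set G : ℝ → ℝ := fun x => 0 + ∫ y in (0 : ℝ)..x, g y with hGdef
  have hGc : ContinuousOn G (uIcc 0 L) := by rw [uIcc_of_le hL.le]; exact hG.continuousOn hL.le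
  have hGi : IntervalIntegrable G volume 0 L := hGc.intervalIntegrable
  obtain ⟨c, hc⟩ := exists_ae_eq_const_of_integral_mul_eq_zero hL (hw.sub hGi) fun η hη hmean => by
    -- The mean-zero condition on `η` is exactly what makes its primitive `θ` vanish at both ends.
    set θ : ℝ → ℝ := fun x => ∫ y in (0 : ℝ)..x, η y with hθ
    have hθd : ∀ x, HasDerivAt θ (η x) x := fun x =>
      intervalIntegral.integral_hasDerivAt_right (hη.intervalIntegrable _ _)
        hη.aestronglyMeasurable.stronglyMeasurableAtFilter hη.continuousAt
    have hθ' : deriv θ = η := funext fun x => (hθd x).deriv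
    have hθc : ContDiff ℝ 1 θ := by
      rw [contDiff_one_iff_deriv, hθ']
      exact ⟨fun x => (hθd x).differentiableAt, hη⟩
    have h0 : θ 0 = 0 := by simp [hθ]
    have h1 := h θ hθc h0 hmean
    have h2 := ((IsIntegralPrimitive.of_contDiff (L := L) hθc).mul hL.le hG).integral_eq_sub hL.le
    rw [h0, show θ L = 0 from hmean] at h2
    rw [hθ'] at h1 h2
    have h3 : ∫ x in (0 : ℝ)..L, η x * (w x - G x)
        = (∫ x in (0 : ℝ)..L, (η x * w x + θ x * g x))
          - ∫ x in (0 : ℝ)..L, (η x * G x + θ x * g x) := by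
      have hθg : IntervalIntegrable (fun x => θ x * g x) volume 0 L :=
        hg.continuousOn_mul hθc.continuous.continuousOn
      rw [← intervalIntegral.integral_sub]
      · exact intervalIntegral.integral_congr fun x _ => by ring
      · exact (hw.continuousOn_mul hη.continuousOn).add hθg
      · exact (hGi.continuousOn_mul hη.continuousOn).add hθg
    rw [h3, h1, h2]
    simp
  refine ⟨fun x => c + ∫ y in (0 : ℝ)..x, g y, IsIntegralPrimitive.of_integral hg c, ?_⟩
  filter_upwards [hc] with x hx
  simp only [hGdef] at hx
  linarith

/-- Regularity and boundary values of a weak solution of `W₁' = g₁`, `W₂' = g₂` with one linear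
boundary condition at each end of `[0, L]`. -/
theorem exists_isIntegralPrimitive_of_weak_bvp {L αh αq βh βq : ℝ} (hL : 0 < L)
    {w₁ w₂ g₁ g₂ : ℝ → ℝ}
    (hw₁ : IntervalIntegrable w₁ volume 0 L) (hw₂ : IntervalIntegrable w₂ volume 0 L)
    (hg₁ : IntervalIntegrable g₁ volume 0 L) (hg₂ : IntervalIntegrable g₂ volume 0 L)
    (h : ∀ θ₁ θ₂ : ℝ → ℝ, ContDiff ℝ 1 θ₁ → ContDiff ℝ 1 θ₂ →
      (∀ ξ₁ ξ₂ : ℝ, αh * ξ₁ + αq * ξ₂ = 0 → θ₁ 0 * ξ₁ + θ₂ 0 * ξ₂ = 0) →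
      (∀ ξ₁ ξ₂ : ℝ, βh * ξ₁ + βq * ξ₂ = 0 → θ₁ L * ξ₁ + θ₂ L * ξ₂ = 0) →
      ∫ x in (0 : ℝ)..L, (deriv θ₁ x * w₁ x + θ₁ x * g₁ x + (deriv θ₂ x * w₂ x + θ₂ x * g₂ x))
        = 0) :
    ∃ W₁ W₂ : ℝ → ℝ, IsIntegralPrimitive L W₁ g₁ ∧ IsIntegralPrimitive L W₂ g₂ ∧
      (∀ᵐ x ∂volume.restrict (Icc 0 L), w₁ x = W₁ x) ∧
      (∀ᵐ x ∂volume.restrict (Icc 0 L), w₂ x = W₂ x) ∧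
      αh * W₁ 0 + αq * W₂ 0 = 0 ∧ βh * W₁ L + βq * W₂ L = 0 := by
  obtain ⟨W₁, hW₁, hww₁⟩ := exists_isIntegralPrimitive_of_weak_deriv hL hw₁ hg₁
    fun θ hθ h0 h1 => by
      simpa using h θ (fun _ => 0) hθ contDiff_const (by simp [h0]) (by simp [h1])
  obtain ⟨W₂, hW₂, hww₂⟩ := exists_isIntegralPrimitive_of_weak_deriv hL hw₂ hg₂
    fun θ hθ h0 h1 => by
      simpa using h (fun _ => 0) θ contDiff_const hθ (by simp [h0]) (by simp [h1])
  -- Once `W₁` and `W₂` are absolutely continuous, integration by parts leaves only the boundary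
  -- terms of the weak equation.
  have hbdry : ∀ θ₁ θ₂ : ℝ → ℝ, ContDiff ℝ 1 θ₁ → ContDiff ℝ 1 θ₂ →
      (∀ ξ₁ ξ₂ : ℝ, αh * ξ₁ + αq * ξ₂ = 0 → θ₁ 0 * ξ₁ + θ₂ 0 * ξ₂ = 0) →
      (∀ ξ₁ ξ₂ : ℝ, βh * ξ₁ + βq * ξ₂ = 0 → θ₁ L * ξ₁ + θ₂ L * ξ₂ = 0) →
      θ₁ L * W₁ L + θ₂ L * W₂ L = θ₁ 0 * W₁ 0 + θ₂ 0 * W₂ 0 := by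
    intro θ₁ θ₂ hθ₁ hθ₂ h0 h1
    have h2 := h θ₁ θ₂ hθ₁ hθ₂ h0 h1
    have h3 := (((IsIntegralPrimitive.of_contDiff hθ₁).mul hL.le hW₁).add
      ((IsIntegralPrimitive.of_contDiff hθ₂).mul hL.le hW₂)).integral_eq_sub hL.le
    have h4 : ∫ x in (0 : ℝ)..L,
        (deriv θ₁ x * w₁ x + θ₁ x * g₁ x + (deriv θ₂ x * w₂ x + θ₂ x * g₂ x))
        = ∫ x in (0 : ℝ)..L,
        (deriv θ₁ x * W₁ x + θ₁ x * g₁ x + (deriv θ₂ x * W₂ x + θ₂ x * g₂ x)) := by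
      rw [intervalIntegral.integral_of_le hL.le, intervalIntegral.integral_of_le hL.le,
        ← integral_Icc_eq_integral_Ioc, ← integral_Icc_eq_integral_Ioc]
      refine integral_congr_ae ?_
      filter_upwards [hww₁, hww₂] with x h1 h2
      rw [h1, h2]
    rw [← h4, h2] at h3
    linarith
  refine ⟨W₁, W₂, hW₁, hW₂, hww₁, hww₂, ?_, ?_⟩
  -- This test pair equals `(αh, αq)` at `0`, which annihilates the admissible boundary values
  -- there, and vanishes at `L`.
  · have := hbdry (fun x => (1 - x / L) * αh) (fun x => (1 - x / L) * αq) (by fun_prop)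
      (by fun_prop) (fun ξ₁ ξ₂ hξ => by simpa using hξ) (fun ξ₁ ξ₂ _ => by simp [hL.ne'])
    simp [hL.ne'] at this
    linarith
  · have := hbdry (fun x => x / L * βh) (fun x => x / L * βq) (by fun_prop)
      (by fun_prop) (fun ξ₁ ξ₂ _ => by simp) (fun ξ₁ ξ₂ hξ => by simpa [hL.ne'] using hξ)
    simp [hL.ne'] at this
    linarith

/-! ### Positivity of the quadratic forms -/

/-- A continuous family of positive definite binary quadratic forms on a compact set is uniformly
positive definite. -/
theorem exists_pos_mul_le_binary_form {K : Set ℝ} (hK : IsCompact K) {k₁ k₂ k₃ : ℝ → ℝ}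
    (hk₁ : ContinuousOn k₁ K) (hk₂ : ContinuousOn k₂ K) (hk₃ : ContinuousOn k₃ K)
    (hpos : ∀ x ∈ K, 0 < k₁ x) (hdet : ∀ x ∈ K, 0 < k₁ x * k₃ x - k₂ x ^ 2) :
    ∃ m : ℝ, 0 < m ∧ ∀ x ∈ K, ∀ u v : ℝ,
      m * (u ^ 2 + v ^ 2) ≤ k₁ x * u ^ 2 + 2 * k₂ x * (u * v) + k₃ x * v ^ 2 := by
  have htr : ∀ x ∈ K, 0 < k₁ x + k₃ x := fun x hx => by
    have h1 := hpos x hx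
    have h2 := hdet x hx
    have h3 : 0 < k₃ x := by
      by_contra h
      nlinarith [sq_nonneg (k₂ x)]
    linarith
  -- The smaller eigenvalue is at least `det / trace`, a positive continuous function of `x`.
  obtain ⟨m, hm, hle⟩ := hK.exists_forall_le' (a := 0)
    (f := fun x => (k₁ x * k₃ x - k₂ x ^ 2) / (k₁ x + k₃ x))
    (((hk₁.mul hk₃).sub (hk₂.pow 2)).div (hk₁.add hk₃) fun x hx => (htr x hx).ne')
    fun x hx => div_pos (hdet x hx) (htr x hx)
  refine ⟨m, hm, fun x hx u v => ?_⟩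
  have h1 := htr x hx
  have h2 : m * (k₁ x + k₃ x) ≤ k₁ x * k₃ x - k₂ x ^ 2 := by
    have := hle x hx
    rwa [le_div_iff₀ h1] at this
  refine le_of_mul_le_mul_left ?_ h1
  -- Cayley–Hamilton: `trace * ⟨ξ, Qξ⟩ - det * |ξ|² = |Qξ|²`.
  nlinarith [sq_nonneg (k₁ x * u + k₂ x * v), sq_nonneg (k₂ x * u + k₃ x * v),
    mul_le_mul_of_nonneg_right h2 (add_nonneg (sq_nonneg u) (sq_nonneg v))]

namespace ErrorSystem

variable {S : ErrorSystem} {p₁ p₂ : ℝ → ℝ} {x : ℝ}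

theorem b_eq (S : ErrorSystem) (x : ℝ) : S.b x = S.lam1 x - S.lam2 x := by
  simp only [lam1, lam2]; ring

theorem IsHyperbolic.a_eq (h : S.IsHyperbolic) (hx : x ∈ Icc 0 S.L) :
    S.a x = S.lam1 x * S.lam2 x := by
  have := Real.sq_sqrt (h.disc_pos x hx).le
  simp only [lam1, lam2]
  linarith

theorem IsHyperbolic.a_pos (h : S.IsHyperbolic) (hx : x ∈ Icc 0 S.L) : 0 < S.a x := by
  rw [h.a_eq hx]
  exact mul_pos (h.lam1_pos x hx) (h.lam2_pos x hx)

theorem P_zero_zero : S.P p₁ p₂ x 0 0 = p₁ x * S.lam2 x ^ 2 + p₂ x * S.lam1 x ^ 2 := by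
  simp [P, N, Matrix.mul_apply, Fin.sum_univ_two]; ring

theorem P_zero_one : S.P p₁ p₂ x 0 1 = p₁ x * S.lam2 x - p₂ x * S.lam1 x := by
  simp [P, N, Matrix.mul_apply, Fin.sum_univ_two]; ring

theorem P_one_zero : S.P p₁ p₂ x 1 0 = p₁ x * S.lam2 x - p₂ x * S.lam1 x := by
  simp [P, N, Matrix.mul_apply, Fin.sum_univ_two]; ring

theorem P_one_one : S.P p₁ p₂ x 1 1 = p₁ x + p₂ x := by
  simp [P, N, Matrix.mul_apply, Fin.sum_univ_two]

theorem M_zero_zero : S.M p₁ p₂ x 0 0 = S.P p₁ p₂ x 0 1 * S.a x := by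
  simp [M, A, Matrix.mul_apply, Fin.sum_univ_two]

theorem M_zero_one :
    S.M p₁ p₂ x 0 1 = S.P p₁ p₂ x 0 0 + S.P p₁ p₂ x 0 1 * S.b x := by
  simp [M, A, Matrix.mul_apply, Fin.sum_univ_two]

theorem M_one_zero : S.M p₁ p₂ x 1 0 = S.P p₁ p₂ x 1 1 * S.a x := by
  simp [M, A, Matrix.mul_apply, Fin.sum_univ_two]

theorem M_one_one :
    S.M p₁ p₂ x 1 1 = S.P p₁ p₂ x 1 0 + S.P p₁ p₂ x 1 1 * S.b x := by
  simp [M, A, Matrix.mul_apply, Fin.sum_univ_two]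

/-- The quadratic form of `M` in the characteristic coordinates. -/
theorem IsHyperbolic.M_form_eq (h : S.IsHyperbolic) (hx : x ∈ Icc 0 S.L) (u v : ℝ) :
    S.M p₁ p₂ x 0 0 * (u * u) + (S.M p₁ p₂ x 0 1 + S.M p₁ p₂ x 1 0) * (u * v)
      + S.M p₁ p₂ x 1 1 * (v * v)
      = p₁ x * S.lam1 x * (S.lam2 x * u + v) ^ 2 - p₂ x * S.lam2 x * (v - S.lam1 x * u) ^ 2 := by
  rw [M_zero_zero, M_zero_one, M_one_zero, M_one_one, P_zero_zero, P_zero_one, P_one_zero,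
    P_one_one, h.a_eq hx, b_eq]
  ring

/-- At `0` the boundary condition says that the incoming coordinate `λ₂ u + v` is `r` times the
outgoing one `v - λ₁ u`. Condition (a1) bounds the reflection coefficient `r` so that the outgoing
part of the form dominates. -/
theorem IsHyperbolic.M_form_nonpos_left (h : S.IsHyperbolic) (hL : 0 < S.L) (h₁ : 0 < p₁ 0)
    (hA : S.ConditionA1 p₁ p₂) {u v : ℝ} (huv : S.αh * u + S.αq * v = 0) :
    S.M p₁ p₂ 0 0 0 * (u * u) + (S.M p₁ p₂ 0 0 1 + S.M p₁ p₂ 0 1 0) * (u * v)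
      + S.M p₁ p₂ 0 1 1 * (v * v) ≤ 0 := by
  have h0 : (0 : ℝ) ∈ Icc 0 S.L := ⟨le_rfl, hL.le⟩
  rw [h.M_form_eq h0]
  have l1 := h.lam1_pos 0 h0
  have l2 := h.lam2_pos 0 h0
  obtain ⟨hne, hlt⟩ := hA
  set r := (S.αh - S.αq * S.lam2 0) / (S.αh + S.αq * S.lam1 0) with hr
  have h3 : S.lam2 0 * u + v = r * (v - S.lam1 0 * u) := by
    rw [hr, div_mul_eq_mul_div, eq_div_iff hne]
    linear_combination (S.lam1 0 + S.lam2 0) * huv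
  have h4 : p₁ 0 * S.lam1 0 * r ^ 2 ≤ p₂ 0 * S.lam2 0 := by
    rw [div_mul_div_comm, lt_div_iff₀ (by positivity)] at hlt
    linarith
  rw [h3, mul_pow, ← mul_assoc]
  linarith [mul_le_mul_of_nonneg_right h4 (sq_nonneg (v - S.lam1 0 * u))]

/-- The same reflection argument at `L`, where the incoming and outgoing coordinates exchange roles.
-/
theorem IsHyperbolic.M_form_nonneg_right (h : S.IsHyperbolic) (hL : 0 < S.L) (h₂ : 0 < p₂ S.L)
    (hA : S.ConditionA2 p₁ p₂) {u v : ℝ} (huv : S.βh * u + S.βq * v = 0) :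
    0 ≤ S.M p₁ p₂ S.L 0 0 * (u * u) + (S.M p₁ p₂ S.L 0 1 + S.M p₁ p₂ S.L 1 0) * (u * v)
      + S.M p₁ p₂ S.L 1 1 * (v * v) := by
  have h0 : S.L ∈ Icc 0 S.L := ⟨hL.le, le_rfl⟩
  rw [h.M_form_eq h0]
  have l1 := h.lam1_pos S.L h0
  have l2 := h.lam2_pos S.L h0
  obtain ⟨hne, hlt⟩ := hA
  set r := (S.βh + S.βq * S.lam1 S.L) / (S.βh - S.βq * S.lam2 S.L) with hr
  have h3 : v - S.lam1 S.L * u = r * (S.lam2 S.L * u + v) := by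
    rw [hr, div_mul_eq_mul_div, eq_div_iff hne]
    linear_combination -(S.lam1 S.L + S.lam2 S.L) * huv
  have h4 : p₂ S.L * S.lam2 S.L * r ^ 2 ≤ p₁ S.L * S.lam1 S.L := by
    rw [div_mul_div_comm, lt_div_iff₀ (by positivity)] at hlt
    linarith
  rw [h3, mul_pow, ← mul_assoc (p₂ S.L * S.lam2 S.L)]
  linarith [mul_le_mul_of_nonneg_right h4 (sq_nonneg (S.lam2 S.L * u + v))]

theorem contDiffOn_sqrt_disc (hreg : S.IsRegular) (h : S.IsHyperbolic) :
    ContDiffOn ℝ 1 (fun x => √(S.b x ^ 2 + 4 * S.a x)) (Icc 0 S.L) :=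
  ((hreg.b_contDiffOn.pow 2).add (contDiffOn_const.mul hreg.a_contDiffOn)).sqrt
    fun x hx => (h.disc_pos x hx).ne'

theorem contDiffOn_lam1 (hreg : S.IsRegular) (h : S.IsHyperbolic) :
    ContDiffOn ℝ 1 S.lam1 (Icc 0 S.L) :=
  (hreg.b_contDiffOn.add (contDiffOn_sqrt_disc hreg h)).div_const 2

theorem contDiffOn_lam2 (hreg : S.IsRegular) (h : S.IsHyperbolic) :
    ContDiffOn ℝ 1 S.lam2 (Icc 0 S.L) :=
  ((hreg.b_contDiffOn.sub (contDiffOn_sqrt_disc hreg h)).div_const 2).neg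

theorem contDiffOn_P (hreg : S.IsRegular) (h : S.IsHyperbolic) (h₁ : S.IsWeight p₁)
    (h₂ : S.IsWeight p₂) (i j : Fin 2) :
    ContDiffOn ℝ 1 (fun x => S.P p₁ p₂ x i j) (Icc 0 S.L) := by
  have l1 := contDiffOn_lam1 hreg h
  have l2 := contDiffOn_lam2 hreg h
  fin_cases i <;> fin_cases j <;>
    simp only [Fin.zero_eta, Fin.mk_one, P_zero_zero, P_zero_one, P_one_zero, P_one_one]
  · exact (h₁.1.mul (l2.pow 2)).add (h₂.1.mul (l1.pow 2))
  · exact (h₁.1.mul l2).sub (h₂.1.mul l1)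
  · exact (h₁.1.mul l2).sub (h₂.1.mul l1)
  · exact h₁.1.add h₂.1

theorem contDiffOn_M (hreg : S.IsRegular) (h : S.IsHyperbolic) (h₁ : S.IsWeight p₁)
    (h₂ : S.IsWeight p₂) (i j : Fin 2) :
    ContDiffOn ℝ 1 (fun x => S.M p₁ p₂ x i j) (Icc 0 S.L) := by
  have hP := contDiffOn_P hreg h h₁ h₂
  fin_cases i <;> fin_cases j <;>
    simp only [Fin.zero_eta, Fin.mk_one, M_zero_zero, M_zero_one, M_one_zero, M_one_one]
  · exact (hP 0 1).mul hreg.a_contDiffOn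
  · exact (hP 0 0).add ((hP 0 1).mul hreg.b_contDiffOn)
  · exact (hP 1 1).mul hreg.a_contDiffOn
  · exact (hP 1 0).add ((hP 1 1).mul hreg.b_contDiffOn)

theorem continuousOn_Mx (hreg : S.IsRegular) (h : S.IsHyperbolic) (h₁ : S.IsWeight p₁)
    (h₂ : S.IsWeight p₂) (i j : Fin 2) :
    ContinuousOn (fun x => S.Mx p₁ p₂ x i j) (Icc 0 S.L) :=
  (contDiffOn_M hreg h h₁ h₂ i j).continuousOn_derivWithin (uniqueDiffOn_Icc hreg.L_pos) le_rfl

theorem continuousOn_B_one_zero (hreg : S.IsRegular) :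
    ContinuousOn (fun x => S.B x 1 0) (Icc 0 S.L) :=
  (hreg.a_contDiffOn.continuousOn_derivWithin (uniqueDiffOn_Icc hreg.L_pos) le_rfl).add
    hreg.aTilde_continuousOn

theorem continuousOn_B_one_one (hreg : S.IsRegular) :
    ContinuousOn (fun x => S.B x 1 1) (Icc 0 S.L) :=
  (hreg.b_contDiffOn.continuousOn_derivWithin (uniqueDiffOn_Icc hreg.L_pos) le_rfl).add
    hreg.bTilde_continuousOn

/-- Uniform positivity of the dissipation form. -/
theorem exists_pos_dissipation (hreg : S.IsRegular) (h : S.IsHyperbolic) (h₁ : S.IsWeight p₁)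
    (h₂ : S.IsWeight p₂) (hB : S.ConditionB p₁ p₂) :
    ∃ m : ℝ, 0 < m ∧ ∀ x ∈ Icc 0 S.L, ∀ u v : ℝ, m * (u ^ 2 + v ^ 2) ≤
      (-S.Mx p₁ p₂ x 0 0 + 2 * (S.P p₁ p₂ x 0 1 * S.B x 1 0)) * u ^ 2
      + (-(S.Mx p₁ p₂ x 0 1 + S.Mx p₁ p₂ x 1 0)
          + 2 * (S.P p₁ p₂ x 0 1 * S.B x 1 1 + S.P p₁ p₂ x 1 1 * S.B x 1 0)) * (u * v)
      + (-S.Mx p₁ p₂ x 1 1 + 2 * (S.P p₁ p₂ x 1 1 * S.B x 1 1)) * v ^ 2 := by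
  have hP := fun i j => (contDiffOn_P hreg h h₁ h₂ i j).continuousOn
  have hM := continuousOn_Mx hreg h h₁ h₂
  have b0 := continuousOn_B_one_zero hreg
  have b1 := continuousOn_B_one_one hreg
  have hsymm : ∀ x, S.P p₁ p₂ x 1 0 = S.P p₁ p₂ x 0 1 := fun x => by
    rw [P_one_zero, P_zero_one]
  have hB0 : ∀ x j, S.B x 0 j = 0 := fun x j => by fin_cases j <;> simp [B]
  have entries : ∀ x i j, (-S.Mx p₁ p₂ x + (S.B x)ᵀ * S.P p₁ p₂ x + S.P p₁ p₂ x * S.B x) i j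
      = -S.Mx p₁ p₂ x i j + S.B x 1 i * S.P p₁ p₂ x 1 j + S.P p₁ p₂ x i 1 * S.B x 1 j := by
    intro x i j
    simp [Matrix.mul_apply, Fin.sum_univ_two, hB0]
  -- Symmetry is part of positive definiteness; it lets twice one off-diagonal entry stand for the
  -- sum of both.
  have hpd : ∀ x ∈ Icc 0 S.L,
      -S.Mx p₁ p₂ x 0 1 + S.B x 1 0 * S.P p₁ p₂ x 1 1 + S.P p₁ p₂ x 0 1 * S.B x 1 1
        = -S.Mx p₁ p₂ x 1 0 + S.B x 1 1 * S.P p₁ p₂ x 1 0 + S.P p₁ p₂ x 1 1 * S.B x 1 0 := by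
    intro x hx
    have h1 := (hB x hx).isHermitian.apply 0 1
    rw [entries, entries] at h1
    simpa using h1.symm
  obtain ⟨m, hm, hle⟩ := exists_pos_mul_le_binary_form (isCompact_Icc (a := 0) (b := S.L))
    (k₁ := fun x => -S.Mx p₁ p₂ x 0 0 + S.B x 1 0 * S.P p₁ p₂ x 1 0 + S.P p₁ p₂ x 0 1 * S.B x 1 0)
    (k₂ := fun x => -S.Mx p₁ p₂ x 0 1 + S.B x 1 0 * S.P p₁ p₂ x 1 1 + S.P p₁ p₂ x 0 1 * S.B x 1 1)
    (k₃ := fun x => -S.Mx p₁ p₂ x 1 1 + S.B x 1 1 * S.P p₁ p₂ x 1 1 + S.P p₁ p₂ x 1 1 * S.B x 1 1)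
    (((hM 0 0).neg.add (b0.mul (hP 1 0))).add ((hP 0 1).mul b0))
    (((hM 0 1).neg.add (b0.mul (hP 1 1))).add ((hP 0 1).mul b1))
    (((hM 1 1).neg.add (b1.mul (hP 1 1))).add ((hP 1 1).mul b1))
    (fun x hx => by
      have h1 := (hB x hx).diag_pos (i := 0)
      rwa [entries] at h1)
    (fun x hx => by
      have h1 := (hB x hx).det_pos
      rw [Matrix.det_fin_two, entries, entries, entries, entries, ← hpd x hx] at h1
      rw [sq]
      exact h1)
  refine ⟨m, hm, fun x hx u v => (hle x hx u v).trans (le_of_eq ?_)⟩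
  have h1 := hpd x hx
  have h2 := hsymm x
  simp only [h2] at h1 ⊢
  linear_combination u * v * h1

/-- `P` is congruent through `N` to `diag(p₁, p₂)`, and `det N = λ₁ + λ₂ > 0`. The bound makes the
`P`-weighted scalar product coercive. -/
theorem exists_pos_weight (hreg : S.IsRegular) (h : S.IsHyperbolic) (h₁ : S.IsWeight p₁)
    (h₂ : S.IsWeight p₂) :
    ∃ c : ℝ, 0 < c ∧ ∀ x ∈ Icc 0 S.L, ∀ u v : ℝ, c * (u ^ 2 + v ^ 2) ≤
      S.P p₁ p₂ x 0 0 * u ^ 2 + 2 * S.P p₁ p₂ x 0 1 * (u * v) + S.P p₁ p₂ x 1 1 * v ^ 2 := by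
  have hP := fun i j => (contDiffOn_P hreg h h₁ h₂ i j).continuousOn
  refine exists_pos_mul_le_binary_form isCompact_Icc (hP 0 0) (hP 0 1) (hP 1 1)
    (fun x hx => ?_) (fun x hx => ?_)
  all_goals
    have := h₁.2 x hx
    have := h₂.2 x hx
    have := h.lam1_pos x hx
    have := h.lam2_pos x hx
  · rw [P_zero_zero]; positivity
  · have : S.P p₁ p₂ x 0 0 * S.P p₁ p₂ x 1 1 - S.P p₁ p₂ x 0 1 ^ 2
        = p₁ x * p₂ x * (S.lam1 x + S.lam2 x) ^ 2 := by
      rw [P_zero_zero, P_zero_one, P_one_one]; ring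
    rw [this]; positivity

/-! ### Multiplication operators and pairings on the state space -/

theorem continuousOn_toEuclideanCLM {K : Set ℝ} {Q : ℝ → Matrix (Fin 2) (Fin 2) ℝ}
    (hQ : ContinuousOn Q K) :
    ContinuousOn (fun x => Matrix.toEuclideanCLM (n := Fin 2) (𝕜 := ℝ) (Q x)) K :=
  (LinearMap.continuous_of_finiteDimensional
    (Matrix.toEuclideanCLM (n := Fin 2) (𝕜 := ℝ)).toAlgEquiv.toLinearMap).comp_continuousOn hQ

/-- Multiplication by a continuous matrix-valued function as an operator on the state space. -/
theorem exists_multiplication_operator (S : ErrorSystem) {Q : ℝ → Matrix (Fin 2) (Fin 2) ℝ}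
    (hQ : ContinuousOn Q (Icc 0 S.L)) :
    ∃ T : S.State →L[ℝ] S.State, ∀ u : S.State,
      ∀ᵐ x ∂volume.restrict (Icc 0 S.L), ∀ i, T u x i = Q x i 0 * u x 0 + Q x i 1 * u x 1 := by
  have hc := continuousOn_toEuclideanCLM hQ
  obtain ⟨C, hC⟩ := isCompact_Icc.exists_bound_of_continuousOn hc
  have hmem : MemLp (fun x => Matrix.toEuclideanCLM (n := Fin 2) (𝕜 := ℝ) (Q x)) ⊤
      (volume.restrict (Icc 0 S.L)) :=
    memLp_top_of_bound (hc.aestronglyMeasurable measurableSet_Icc) C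
      ((ae_restrict_iff' measurableSet_Icc).2 (Eventually.of_forall hC))
  -- The Hölder pairing `L^∞ × L² → L²` for evaluation of operators on vectors.
  refine ⟨(ContinuousLinearMap.id ℝ (EuclideanSpace ℝ (Fin 2) →L[ℝ]
    EuclideanSpace ℝ (Fin 2))).holderL (volume.restrict (Icc 0 S.L)) ⊤ 2 2 (hmem.toLp _),
    fun u => ?_⟩
  filter_upwards [hmem.coeFn_toLp, (ContinuousLinearMap.id ℝ (EuclideanSpace ℝ (Fin 2) →L[ℝ]
    EuclideanSpace ℝ (Fin 2))).coeFn_holder (r := 2) (hmem.toLp _) u] with x h1 h2 i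
  rw [ContinuousLinearMap.holderL_apply_apply, h2, h1]
  simp [Matrix.mulVec, dotProduct, Fin.sum_univ_two]

/-- Pairing with a continuous vector field is a scalar product with an element of the state
space. -/
theorem exists_inner_eq_integral (S : ErrorSystem) {f : ℝ → Fin 2 → ℝ}
    (hf : ContinuousOn f (Icc 0 S.L)) :
    ∃ F : S.State, ∀ u : S.State, ⟪F, u⟫_ℝ = ∫ x in Icc 0 S.L, f x ⬝ᵥ (u x).ofLp := by
  have hc : ContinuousOn (fun x => WithLp.toLp 2 (f x)) (Icc 0 S.L) :=
    (PiLp.continuous_toLp 2 _).comp_continuousOn hf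
  obtain ⟨C, hC⟩ := isCompact_Icc.exists_bound_of_continuousOn hc
  have hmem : MemLp (fun x => WithLp.toLp 2 (f x)) 2 (volume.restrict (Icc 0 S.L)) :=
    MemLp.of_bound (hc.aestronglyMeasurable measurableSet_Icc) C
      ((ae_restrict_iff' measurableSet_Icc).2 (Eventually.of_forall hC))
  refine ⟨hmem.toLp _, fun u => ?_⟩
  rw [L2.inner_def]
  refine integral_congr_ae ?_
  filter_upwards [hmem.coeFn_toLp] with x hx
  rw [hx]
  simp [PiLp.inner_apply, dotProduct, Fin.sum_univ_two, mul_comm]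

theorem intervalIntegrable_coord (hL : 0 < S.L) (u : S.State) (i : Fin 2) :
    IntervalIntegrable (fun x => u x i) volume 0 S.L := by
  rw [intervalIntegrable_iff_integrableOn_Icc_of_le hL.le]
  have h : Integrable u (volume.restrict (Icc 0 S.L)) := (Lp.memLp u).integrable (by norm_num)
  exact (EuclideanSpace.proj (𝕜 := ℝ) i).integrable_comp h

/-! ### The stationary equation for time integrals -/

/-- The stationary test function `φ` with `Aᵀ φ = θ`. -/
noncomputable def stationaryTest (S : ErrorSystem) (θ₁ θ₂ : ℝ → ℝ) (x : ℝ) : Fin 2 → ℝ :=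
  ![θ₂ x - S.b x * (θ₁ x / S.a x), θ₁ x / S.a x]

theorem A_transpose_mulVec_stationaryTest {θ₁ θ₂ : ℝ → ℝ} (ha : S.a x ≠ 0) :
    (S.A x)ᵀ *ᵥ S.stationaryTest θ₁ θ₂ x = ![θ₁ x, θ₂ x] := by
  ext i
  fin_cases i <;> simp [A, stationaryTest, Matrix.mulVec, dotProduct, Fin.sum_univ_two]
  field_simp

theorem stationaryTest_dotProduct_A_mulVec {θ₁ θ₂ : ℝ → ℝ} (ha : S.a x ≠ 0) (ξ : Fin 2 → ℝ) :
    S.stationaryTest θ₁ θ₂ x ⬝ᵥ (S.A x *ᵥ ξ) = θ₁ x * ξ 0 + θ₂ x * ξ 1 := by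
  rw [Matrix.dotProduct_mulVec, ← Matrix.mulVec_transpose, A_transpose_mulVec_stationaryTest ha]
  simp [dotProduct, Fin.sum_univ_two]

theorem contDiffOn_stationaryTest (hreg : S.IsRegular) (h : S.IsHyperbolic) {θ₁ θ₂ : ℝ → ℝ}
    (hθ₁ : ContDiff ℝ 1 θ₁) (hθ₂ : ContDiff ℝ 1 θ₂) :
    ContDiffOn ℝ 1 (S.stationaryTest θ₁ θ₂) (Icc 0 S.L) := by
  have h1 : ContDiffOn ℝ 1 (fun x => θ₁ x / S.a x) (Icc 0 S.L) :=
    hθ₁.contDiffOn.div hreg.a_contDiffOn fun x hx => (h.a_pos hx).ne'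
  rw [contDiffOn_pi]
  intro i
  fin_cases i
  · exact hθ₂.contDiffOn.sub (hreg.b_contDiffOn.mul h1)
  · exact h1

/-- Since `φᵀ A ξ = θᵀ ξ`, the adjoint boundary conditions on `φ` become conditions on the free
function `θ`. -/
theorem isTest_stationaryTest (hreg : S.IsRegular) (h : S.IsHyperbolic) {θ₁ θ₂ : ℝ → ℝ}
    (hθ₁ : ContDiff ℝ 1 θ₁) (hθ₂ : ContDiff ℝ 1 θ₂)
    (h0 : ∀ ξ₁ ξ₂ : ℝ, S.αh * ξ₁ + S.αq * ξ₂ = 0 → θ₁ 0 * ξ₁ + θ₂ 0 * ξ₂ = 0)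
    (h1 : ∀ ξ₁ ξ₂ : ℝ, S.βh * ξ₁ + S.βq * ξ₂ = 0 → θ₁ S.L * ξ₁ + θ₂ S.L * ξ₂ = 0) (τ : ℝ) :
    S.IsTest τ (fun _ => S.stationaryTest θ₁ θ₂) where
  contDiffOn := (contDiffOn_stationaryTest hreg h hθ₁ hθ₂).comp contDiff_snd.contDiffOn
    fun _ hy => hy.2
  left t _ ξ hξ := by
    rw [stationaryTest_dotProduct_A_mulVec (h.a_pos ⟨le_rfl, hreg.L_pos.le⟩).ne']
    exact h0 _ _ hξ
  right t _ ξ hξ := by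
    rw [stationaryTest_dotProduct_A_mulVec (h.a_pos ⟨hreg.L_pos.le, le_rfl⟩).ne']
    exact h1 _ _ hξ

/-- The time derivative vanishes and `(Aᵀ φ)_x = θ'`, so `a` and `b` need not be differentiated in
this term. -/
theorem adjointOp_stationaryTest (hreg : S.IsRegular) (h : S.IsHyperbolic) {θ₁ θ₂ : ℝ → ℝ}
    (hθ₁ : ContDiff ℝ 1 θ₁) (hθ₂ : ContDiff ℝ 1 θ₂) (τ t : ℝ) (hx : x ∈ Icc 0 S.L) :
    S.adjointOp τ (fun _ => S.stationaryTest θ₁ θ₂) t x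
      = ![deriv θ₁ x - S.B x 1 0 * (θ₁ x / S.a x), deriv θ₂ x - S.B x 1 1 * (θ₁ x / S.a x)] := by
  have h1 : derivWithin (fun y => (S.A y)ᵀ *ᵥ S.stationaryTest θ₁ θ₂ y) (Icc 0 S.L) x
      = ![deriv θ₁ x, deriv θ₂ x] := by
    have hd : HasDerivWithinAt (fun y => ![θ₁ y, θ₂ y]) ![deriv θ₁ x, deriv θ₂ x] (Icc 0 S.L) x := by
      rw [hasDerivWithinAt_pi]
      intro i
      fin_cases i
      · exact (hθ₁.differentiable one_ne_zero x).hasDerivAt.hasDerivWithinAt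
      · exact (hθ₂.differentiable one_ne_zero x).hasDerivAt.hasDerivWithinAt
    refine (hd.congr (fun y hy => ?_) ?_).derivWithin (uniqueDiffOn_Icc hreg.L_pos x hx)
    · exact A_transpose_mulVec_stationaryTest (h.a_pos hy).ne'
    · exact A_transpose_mulVec_stationaryTest (h.a_pos hx).ne'
  rw [adjointOp, h1, derivWithin_fun_const]
  ext i
  fin_cases i <;> simp [B, stationaryTest]

/-- The first component of `-A⁻¹ (v + B w)`; the second one is `-v₁`. -/
noncomputable def fluxDeriv (S : ErrorSystem) (w v : S.State) (x : ℝ) : ℝ :=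
  -(v x 1 - S.b x * v x 0 + S.B x 1 0 * w x 0 + S.B x 1 1 * w x 1) / S.a x

/-- The increments of a weak solution and its time averages satisfy the stationary equation
`v + A w' + B w = 0` weakly. -/
theorem IsL2Solution.weak_stationary (hreg : S.IsRegular) (h : S.IsHyperbolic) {z₀ : S.State}
    {z : ℝ → S.State} (hz : S.IsL2Solution z₀ z) {t ε : ℝ} (ht : 0 ≤ t) (hε : 0 < ε)
    {θ₁ θ₂ : ℝ → ℝ} (hθ₁ : ContDiff ℝ 1 θ₁) (hθ₂ : ContDiff ℝ 1 θ₂)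
    (h0 : ∀ ξ₁ ξ₂ : ℝ, S.αh * ξ₁ + S.αq * ξ₂ = 0 → θ₁ 0 * ξ₁ + θ₂ 0 * ξ₂ = 0)
    (h1 : ∀ ξ₁ ξ₂ : ℝ, S.βh * ξ₁ + S.βq * ξ₂ = 0 → θ₁ S.L * ξ₁ + θ₂ S.L * ξ₂ = 0)
    {w v : S.State} (hw : w = ∫ s in t..t + ε, z s) (hv : v = z (t + ε) - z t) :
    ∫ x in (0 : ℝ)..S.L, (deriv θ₁ x * w x 0 + θ₁ x * S.fluxDeriv w v x
      + (deriv θ₂ x * w x 1 + θ₂ x * -v x 0)) = 0 := by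
  set φ := S.stationaryTest θ₁ θ₂ with hφ
  set ψ : ℝ → Fin 2 → ℝ := fun x =>
    ![deriv θ₁ x - S.B x 1 0 * (θ₁ x / S.a x), deriv θ₂ x - S.B x 1 1 * (θ₁ x / S.a x)] with hψ
  have hφc : ContinuousOn φ (Icc 0 S.L) :=
    (contDiffOn_stationaryTest hreg h hθ₁ hθ₂).continuousOn
  have hq : ContinuousOn (fun x => θ₁ x / S.a x) (Icc 0 S.L) :=
    hθ₁.continuous.continuousOn.div hreg.a_contDiffOn.continuousOn fun x hx => (h.a_pos hx).ne'
  have hψc : ContinuousOn ψ (Icc 0 S.L) := by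
    rw [continuousOn_pi]
    intro i
    fin_cases i
    · exact (hθ₁.continuous_deriv le_rfl).continuousOn.sub ((continuousOn_B_one_zero hreg).mul hq)
    · exact (hθ₂.continuous_deriv le_rfl).continuousOn.sub ((continuousOn_B_one_one hreg).mul hq)
  obtain ⟨F, hF⟩ := S.exists_inner_eq_integral hφc
  obtain ⟨G, hG⟩ := S.exists_inner_eq_integral hψc
  have hGz : ContinuousOn (fun s => ⟪G, z s⟫_ℝ) (Ici 0) := continuousOn_const.inner hz.continuousOn
  have hii : ∀ r s, 0 ≤ r → 0 ≤ s → IntervalIntegrable (fun s => ⟪G, z s⟫_ℝ) volume r s :=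
    fun r s hr hs => (hGz.mono fun y hy => (le_inf hr hs).trans hy.1).intervalIntegrable
  -- `F` represents `φ` and `G` its adjoint image; both are independent of time, so the weak
  -- equation is an integral identity for scalar functions of time. The case `τ = 0` is trivial and
  -- lies outside the weak formulation.
  have hweak : ∀ τ, 0 ≤ τ → ⟪F, z τ⟫_ℝ - ⟪F, z 0⟫_ℝ = ∫ s in (0 : ℝ)..τ, ⟪G, z s⟫_ℝ := by
    intro τ hτ
    rcases hτ.eq_or_lt with rfl | hτ
    · simp
    have h2 := hz.weak τ hτ _ (isTest_stationaryTest hreg h hθ₁ hθ₂ h0 h1 τ)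
    rw [hz.initial, hF, hF, h2, intervalIntegral.integral_of_le hτ.le,
      ← integral_Icc_eq_integral_Ioc]
    refine integral_congr_ae (Eventually.of_forall fun s => ?_)
    simp only [hG]
    refine setIntegral_congr_fun measurableSet_Icc fun x hx => ?_
    simp only [adjointOp_stationaryTest hreg h hθ₁ hθ₂ τ s hx, hψ]
  -- Subtract the identities at `t + ε` and `t`, and pull `G` out of the vector-valued integral.
  have hFG : ⟪F, v⟫_ℝ = ⟪G, w⟫_ℝ := by
    have hzi : IntervalIntegrable z volume t (t + ε) :=
      (hz.continuousOn.mono fun y hy => by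
        rw [uIcc_of_le (by linarith)] at hy
        exact ht.trans hy.1).intervalIntegrable
    have h2 := hweak t ht
    have h3 := hweak (t + ε) (by linarith)
    have h4 : ∫ s in t..t + ε, ⟪G, z s⟫_ℝ = ⟪G, w⟫_ℝ := by
      rw [hw]
      exact (innerSL ℝ G).intervalIntegral_comp_comm hzi
    have h5 := intervalIntegral.integral_interval_sub_left
      (hii 0 (t + ε) le_rfl (by linarith)) (hii 0 t le_rfl ht)
    rw [hv, inner_sub_right, ← h4, ← h5]
    linarith
  have hint : ∀ {f : ℝ → Fin 2 → ℝ} (_ : ContinuousOn f (Icc 0 S.L)) (u : S.State),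
      IntegrableOn (fun x => f x ⬝ᵥ (u x).ofLp) (Icc 0 S.L) := by
    intro f hf u
    have hf' : ContinuousOn f (uIcc 0 S.L) := by rwa [uIcc_of_le hreg.L_pos.le]
    rw [continuousOn_pi] at hf'
    rw [← intervalIntegrable_iff_integrableOn_Icc_of_le hreg.L_pos.le]
    simp only [dotProduct, Fin.sum_univ_two]
    exact ((intervalIntegrable_coord hreg.L_pos u 0).continuousOn_mul (hf' 0)).add
      ((intervalIntegrable_coord hreg.L_pos u 1).continuousOn_mul (hf' 1))
  rw [hF, hG, eq_comm, ← sub_eq_zero, ← integral_sub (hint hψc w) (hint hφc v)] at hFG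
  rw [intervalIntegral.integral_of_le hreg.L_pos.le, ← integral_Icc_eq_integral_Ioc]
  refine (setIntegral_congr_fun measurableSet_Icc fun x hx => ?_).trans hFG
  have ha := (h.a_pos hx).ne'
  simp [hφ, hψ, fluxDeriv, stationaryTest, dotProduct, Fin.sum_univ_two]
  field_simp
  ring

theorem intervalIntegrable_fluxDeriv (hreg : S.IsRegular) (h : S.IsHyperbolic) (w v : S.State) :
    IntervalIntegrable (S.fluxDeriv w v) volume 0 S.L := by
  have hI : uIcc 0 S.L = Icc 0 S.L := uIcc_of_le hreg.L_pos.le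
  have hc := intervalIntegrable_coord hreg.L_pos
  have hinv : ContinuousOn (fun x => (S.a x)⁻¹) (uIcc 0 S.L) := by
    rw [hI]
    exact hreg.a_contDiffOn.continuousOn.inv₀ fun x hx => (h.a_pos hx).ne'
  exact ((((hc v 1).sub ((hc v 0).continuousOn_mul
    (by rw [hI]; exact hreg.b_contDiffOn.continuousOn))).add
    ((hc w 0).continuousOn_mul (by rw [hI]; exact continuousOn_B_one_zero hreg))).add
    ((hc w 1).continuousOn_mul (by rw [hI]; exact continuousOn_B_one_one hreg))).neg.mul_continuousOn
    hinv

/-! ### The Lyapunov inequality -/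

/-- Derivative of the form `W ↦ Wᵀ M W` along a function `W` with derivative `g`. -/
noncomputable def formDeriv (S : ErrorSystem) (p₁ p₂ : ℝ → ℝ) (w₁ w₂ g₁ g₂ : ℝ → ℝ) (x : ℝ) : ℝ :=
  S.Mx p₁ p₂ x 0 0 * (w₁ x * w₁ x) + S.M p₁ p₂ x 0 0 * (g₁ x * w₁ x + w₁ x * g₁ x)
  + ((S.Mx p₁ p₂ x 0 1 + S.Mx p₁ p₂ x 1 0) * (w₁ x * w₂ x)
      + (S.M p₁ p₂ x 0 1 + S.M p₁ p₂ x 1 0) * (g₁ x * w₂ x + w₁ x * g₂ x))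
  + (S.Mx p₁ p₂ x 1 1 * (w₂ x * w₂ x) + S.M p₁ p₂ x 1 1 * (g₂ x * w₂ x + w₂ x * g₂ x))

/-- The product rule for absolutely continuous functions; it turns the integral of `(Wᵀ M W)'` into
boundary terms although `W'` is only integrable. -/
theorem isIntegralPrimitive_M_form (hreg : S.IsRegular) (h : S.IsHyperbolic) (h₁ : S.IsWeight p₁)
    (h₂ : S.IsWeight p₂) {W₁ W₂ g₁ g₂ : ℝ → ℝ} (hW₁ : IsIntegralPrimitive S.L W₁ g₁)
    (hW₂ : IsIntegralPrimitive S.L W₂ g₂) :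
    IsIntegralPrimitive S.L
      (fun x => S.M p₁ p₂ x 0 0 * (W₁ x * W₁ x)
        + (S.M p₁ p₂ x 0 1 + S.M p₁ p₂ x 1 0) * (W₁ x * W₂ x) + S.M p₁ p₂ x 1 1 * (W₂ x * W₂ x))
      (S.formDeriv p₁ p₂ W₁ W₂ g₁ g₂) := by
  have hL := hreg.L_pos
  have hM := fun i j => IsIntegralPrimitive.of_contDiffOn hL (contDiffOn_M hreg h h₁ h₂ i j)
  exact (((hM 0 0).mul hL.le (hW₁.mul hL.le hW₁)).add
    (((hM 0 1).add (hM 1 0)).mul hL.le (hW₁.mul hL.le hW₂))).add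
    ((hM 1 1).mul hL.le (hW₂.mul hL.le hW₂))

/-- Lyapunov inequality: the weak stationary equation `v + A w' + B w = 0` with the boundary
conditions implies dissipation in the scalar product weighted by `P`. -/
theorem dissipation (hreg : S.IsRegular) (h : S.IsHyperbolic) (h₁ : S.IsWeight p₁)
    (h₂ : S.IsWeight p₂) (hA₁ : S.ConditionA1 p₁ p₂) (hA₂ : S.ConditionA2 p₁ p₂) {m : ℝ}
    (hm : ∀ x ∈ Icc 0 S.L, ∀ u v : ℝ, m * (u ^ 2 + v ^ 2) ≤
      (-S.Mx p₁ p₂ x 0 0 + 2 * (S.P p₁ p₂ x 0 1 * S.B x 1 0)) * u ^ 2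
      + (-(S.Mx p₁ p₂ x 0 1 + S.Mx p₁ p₂ x 1 0)
          + 2 * (S.P p₁ p₂ x 0 1 * S.B x 1 1 + S.P p₁ p₂ x 1 1 * S.B x 1 0)) * (u * v)
      + (-S.Mx p₁ p₂ x 1 1 + 2 * (S.P p₁ p₂ x 1 1 * S.B x 1 1)) * v ^ 2)
    {T : S.State →L[ℝ] S.State}
    (hT : ∀ u : S.State, ∀ᵐ x ∂volume.restrict (Icc 0 S.L), ∀ i,
      T u x i = S.P p₁ p₂ x i 0 * u x 0 + S.P p₁ p₂ x i 1 * u x 1)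
    {w v : S.State}
    (hwv : ∀ θ₁ θ₂ : ℝ → ℝ, ContDiff ℝ 1 θ₁ → ContDiff ℝ 1 θ₂ →
      (∀ ξ₁ ξ₂ : ℝ, S.αh * ξ₁ + S.αq * ξ₂ = 0 → θ₁ 0 * ξ₁ + θ₂ 0 * ξ₂ = 0) →
      (∀ ξ₁ ξ₂ : ℝ, S.βh * ξ₁ + S.βq * ξ₂ = 0 → θ₁ S.L * ξ₁ + θ₂ S.L * ξ₂ = 0) →
      ∫ x in (0 : ℝ)..S.L, (deriv θ₁ x * w x 0 + θ₁ x * S.fluxDeriv w v x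
        + (deriv θ₂ x * w x 1 + θ₂ x * -v x 0)) = 0) :
    2 * ⟪v, T w⟫_ℝ ≤ -m * ‖w‖ ^ 2 := by
  have hL := hreg.L_pos
  have hc := intervalIntegrable_coord hL
  obtain ⟨W₁, W₂, hW₁, hW₂, hw₁, hw₂, hb0, hbL⟩ :=
    exists_isIntegralPrimitive_of_weak_bvp (g₂ := fun x => -v x 0) hL (hc w 0) (hc w 1)
      (intervalIntegrable_fluxDeriv hreg h w v) (hc v 0).neg hwv
  have hprim := isIntegralPrimitive_M_form hreg h h₁ h₂ hW₁ hW₂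
  have hint := hprim.integral_eq_sub hL.le
  have hleft := h.M_form_nonpos_left hL (h₁.2 0 ⟨le_rfl, hL.le⟩) hA₁ hb0
  have hright := h.M_form_nonneg_right hL (h₂.2 S.L ⟨hL.le, le_rfl⟩) hA₂ hbL
  rw [intervalIntegral.integral_of_le hL.le, ← integral_Icc_eq_integral_Ioc] at hint
  have hE := (intervalIntegrable_iff_integrableOn_Icc_of_le hL.le).1 hprim.1
  have hvT : Integrable (fun x => ⟪v x, T w x⟫_ℝ) (volume.restrict (Icc 0 S.L)) :=
    L2.integrable_inner v (T w)
  have hww : Integrable (fun x => ⟪w x, w x⟫_ℝ) (volume.restrict (Icc 0 S.L)) :=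
    L2.integrable_inner w w
  have hsum : 2 * ⟪v, T w⟫_ℝ + m * ‖w‖ ^ 2
      = ∫ x in Icc 0 S.L, (2 * ⟪v x, T w x⟫_ℝ + m * ⟪w x, w x⟫_ℝ) := by
    rw [integral_add (hvT.const_mul 2) (hww.const_mul m), integral_const_mul, integral_const_mul,
      ← L2.inner_def, ← L2.inner_def, real_inner_self_eq_norm_sq]
  -- Pointwise, `v = -A w' - B w` gives `2 vᵀ P w = -(wᵀ M w)' + wᵀ M_x w - 2 wᵀ P B w`, and the
  -- last two terms are at most `-m |w|²`. The integrated derivative is then controlled by `hleft`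
  -- and `hright`.
  have hle : ∫ x in Icc 0 S.L, (2 * ⟪v x, T w x⟫_ℝ + m * ⟪w x, w x⟫_ℝ)
      ≤ ∫ x in Icc 0 S.L, -S.formDeriv p₁ p₂ W₁ W₂ (S.fluxDeriv w v) (fun x => -v x 0) x := by
    refine integral_mono_ae ((hvT.const_mul 2).add (hww.const_mul m)) hE.neg ?_
    filter_upwards [hw₁, hw₂, hT w, ae_restrict_mem measurableSet_Icc] with x e1 e2 e3 hx
    have hmx := hm x hx (w x 0) (w x 1)
    have ha := (h.a_pos hx).ne'
    have hg : S.a x * S.fluxDeriv w v x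
        = -(v x 1 - S.b x * v x 0 + S.B x 1 0 * w x 0 + S.B x 1 1 * w x 1) := by
      rw [fluxDeriv]; field_simp
    have hPs : S.P p₁ p₂ x 1 0 = S.P p₁ p₂ x 0 1 := by rw [P_one_zero, P_zero_one]
    -- Symmetry of `M = Nᵀ diag(p₁ λ₁, -p₂ λ₂) N` is what makes `2 wᵀ M w'` part of an exact
    -- derivative.
    have hMs : S.M p₁ p₂ x 0 1 = S.M p₁ p₂ x 1 0 := by
      rw [M_zero_one, M_one_zero, P_zero_zero, P_zero_one, P_one_one, h.a_eq hx, b_eq]; ring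
    have hv1 : v x 1 = -(S.a x * S.fluxDeriv w v x) + S.b x * v x 0
        - S.B x 1 0 * w x 0 - S.B x 1 1 * w x 1 := by linarith
    simp only [PiLp.inner_apply, Fin.sum_univ_two, e3, formDeriv, ← e1, ← e2,
      RCLike.inner_apply, conj_trivial]
    rw [hPs]
    generalize S.fluxDeriv w v x = g at *
    have hM01 : S.M p₁ p₂ x 0 1 = S.P p₁ p₂ x 0 0 + S.P p₁ p₂ x 0 1 * S.b x := M_zero_one
    have hM00 : S.M p₁ p₂ x 0 0 = S.P p₁ p₂ x 0 1 * S.a x := M_zero_zero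
    have hM11 : S.M p₁ p₂ x 1 1 = S.P p₁ p₂ x 0 1 + S.P p₁ p₂ x 1 1 * S.b x := by
      rw [M_one_one, hPs]
    have hM10 : S.M p₁ p₂ x 1 0 = S.P p₁ p₂ x 1 1 * S.a x := M_one_zero
    have hsplit : (S.M p₁ p₂ x 0 1 + S.M p₁ p₂ x 1 0) * (g * w x 1 + w x 0 * -v x 0)
        = 2 * (S.P p₁ p₂ x 1 1 * S.a x) * (g * w x 1)
          - 2 * (S.P p₁ p₂ x 0 0 + S.P p₁ p₂ x 0 1 * S.b x) * (w x 0 * v x 0) := by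
      rw [← hM10, ← hM01, hMs]; ring
    rw [hsplit, hM00, hM11, hv1]
    linarith
  rw [integral_neg, hint] at hle
  linarith

end ErrorSystem

/-! ### Exponential stability -/

theorem theorem2 (S : ErrorSystem) (hreg : S.IsRegular) (hhyp : S.IsHyperbolic)
    (hp : ∃ p₁ p₂ : ℝ → ℝ, S.IsWeight p₁ ∧ S.IsWeight p₂ ∧
      S.ConditionA1 p₁ p₂ ∧ S.ConditionA2 p₁ p₂ ∧ S.ConditionB p₁ p₂) :
    S.IsL2ExpStable := by
  obtain ⟨p₁, p₂, h₁, h₂, hA₁, hA₂, hB⟩ := hp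
  obtain ⟨m, hm, hdiss⟩ := ErrorSystem.exists_pos_dissipation hreg hhyp h₁ h₂ hB
  obtain ⟨c, hc, hcoer⟩ := ErrorSystem.exists_pos_weight hreg hhyp h₁ h₂
  have hPc : ContinuousOn (S.P p₁ p₂) (Icc 0 S.L) :=
    continuousOn_pi.2 fun i => continuousOn_pi.2 fun j =>
      (ErrorSystem.contDiffOn_P hreg hhyp h₁ h₂ i j).continuousOn
  have hPs : ∀ x, S.P p₁ p₂ x 1 0 = S.P p₁ p₂ x 0 1 := fun x => by
    rw [ErrorSystem.P_one_zero, ErrorSystem.P_zero_one]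
  -- Multiplication by `P` is the operator defining the equivalent scalar product.
  obtain ⟨T, hT⟩ := S.exists_multiplication_operator hPc
  have hsymm : ∀ u v : S.State, ⟪T u, v⟫_ℝ = ⟪u, T v⟫_ℝ := fun u v => by
    rw [L2.inner_def, L2.inner_def]
    refine integral_congr_ae ?_
    filter_upwards [hT u, hT v] with x hu hv
    simp only [PiLp.inner_apply, Fin.sum_univ_two, hu, hv, hPs, RCLike.inner_apply, conj_trivial]
    ring
  have hpos : ∀ u : S.State, c * ‖u‖ ^ 2 ≤ ⟪u, T u⟫_ℝ := fun u => by
    rw [← real_inner_self_eq_norm_sq, L2.inner_def, L2.inner_def, ← integral_const_mul]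
    refine integral_mono_ae ((L2.integrable_inner u u).const_mul c) (L2.integrable_inner u (T u)) ?_
    filter_upwards [hT u, ae_restrict_mem measurableSet_Icc] with x hu hx
    have := hcoer x hx (u x 0) (u x 1)
    simp only [PiLp.inner_apply, Fin.sum_univ_two, hu, hPs, RCLike.inner_apply, conj_trivial]
    linarith
  obtain ⟨C, hC, ν, hν, key⟩ :=
    exists_exp_decay_of_dissipative_averages T hsymm hc hm hpos
  refine ⟨C, hC, ν, hν, fun z₀ z hz t ht => ?_⟩
  rw [← hz.initial]
  refine key z hz.continuousOn (fun t ht ε hε => ?_) t ht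
  exact ErrorSystem.dissipation hreg hhyp h₁ h₂ hA₁ hA₂ hdiss hT
    fun θ₁ θ₂ hθ₁ hθ₂ h0 h1 => hz.weak_stationary hreg hhyp ht hε hθ₁ hθ₂ h0 h1 rfl rfl
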